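/- **Setting.** Let $L_2$ be the real Hilbert space of square-integrable signals $[0,\infty)\to\mathbb R$. For $T\ge 0$ let $P_T$ be truncation, $(P_Tu)(t)=u(t)$ for $t\le T$ and $0$ for $t>T$, and let $L_{2e}$ be the space of signals $u$ with $P_Tu\in L_2$ for all $T\ge0$. An operator $R:L_2\to L_2$ is causal if $P_T(Ru)=P_T(R(P_Tu))$ for all $u\in L_2$, $T\ge 0$; a causal $R$ extends uniquely to $L_{2e}\to L_{2e}$ by $P_T(Ru):=P_T(R(P_Tu))$. Operators are identified with their graphs; inverses, sums and compositions are those of relations. The incremental gain is $\Gamma(R)=\sup_{u_1\neq u_2}\|Ru_1-Ru_2\|/\|u_1-u_2\|\in[0,\infty]$. The scaled relative graph of an operator $R$ is $$\mathrm{SRG}(R)=\Big\{\tfrac{\|Ru_1-Ru_2\|}{\|u_1-u_2\|}\,e^{\pm j\angle(u_1-u_2,\,Ru_1-Ru_2)} : u_1\ne u_2\Big\},\qquad \angle(u,y)=\arccos\tfrac{\langle u,y\rangle}{\|u\|\,\|y\|}$$ (the point is $0$ if $Ru_1=Ru_2$). For a set $A\subseteq\mathbb C\cup\{\infty\}$,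 $A^{-1}$ is its image under the Möbius inversion $re^{j\omega}\mapsto \frac1r e^{j\omega}$, which exchanges $0$ and $\infty$; $\mathrm{dist}(A,B)=\inf_{z\in A,\,w\in B}|z-w|$, where $|\infty-\infty|=0$ and $|\infty-z|=\infty$ for $z\in\mathbb C$; and $A$ has the chord property if $[z,\bar z]\subseteq A$ for every $z\in A\setminus\{\infty\}$. **Theorem.** Let $H_1,H_2:L_2\to L_2$ satisfy $\Gamma(H_1)<\infty$ and $\Gamma(H_2)<\infty$, and let at least one of $\mathrm{SRG}(H_1),\mathrm{SRG}(H_2)$ have the chord property. Suppose that there is an $r_m>0$ such that $$\mathrm{dist}\big(\mathrm{SRG}(H_1)^{-1},\,-\tau\,\mathrm{SRG}(H_2)\big)\ge r_m\qquad\text{for all }\tau\in[0,1].$$ Then the feedback interconnection $e=r-H_2y$, $y=H_1e$ is well-posed: for every $r\in L_2$ there are unique $e,y\in L_2$ solving it. The relation $$T=(H_1^{-1}+H_2)^{-1}=H_1(1+H_2H_1)^{-1}$$ from $r$ to $y$ is a (single-valued, everywhere defined) operator $T:L_2\to L_2$, and $\Gamma(T)\le 1/r_m$. If $H_1$ and $H_2$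 are both causal, then $T$ is causal, and the interconnection of the extensions $H_1,H_2:L_{2e}\to L_{2e}$ is well-posed as well: for every $r\in L_2$ there are unique $e,y\in L_{2e}$ with $e=r-H_2y$ and $y=H_1e$. -/

import Mathlib

open MeasureTheory
open scoped ENNReal NNReal

noncomputable section

namespace ScaledRelativeGraph

/-! ### Relations and operators

A relation is its graph, a `SetRel`; an operator `H` is identified with `Function.graph H`. The
relational inverse is `SetRel.inv`, and `R.comp S` is "first `R`, then `S`". -/

/-- The sum of two relations, `(R + S) u = {y + z | y ∈ R u, z ∈ S u}`. -/
def relAdd {X V : Type*} [Add V] (R S : SetRel X V) : SetRel X V :=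
  {p | ∃ y z, (p.1, y) ∈ R ∧ (p.1, z) ∈ S ∧ p.2 = y + z}

/-- The feedback connection `(H₁⁻¹ + H₂)⁻¹`, as a relation from the input `r` to the output `y`. -/
def feedback {V : Type*} [Add V] (H₁ H₂ : V → V) : SetRel V V :=
  (relAdd (Function.graph H₁).inv (Function.graph H₂)).inv

/-- The relation `H₁ (1 + H₂ H₁)⁻¹`. -/
def feedback' {V : Type*} [Add V] (H₁ H₂ : V → V) : SetRel V V :=
  (relAdd SetRel.id ((Function.graph H₁).comp (Function.graph H₂))).inv.comp (Function.graph H₁)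

/-- Well-posedness of the feedback interconnection of `H₁` and `H₂` on the signal space `V`, for
inputs in `S`: for every `r ∈ S` there are unique `e, y ∈ V` with `e = r - H₂ y` and
`y = H₁ e`. -/
def WellPosed {V : Type*} [Sub V] (S : Set V) (H₁ H₂ : V → V) : Prop :=
  ∀ r ∈ S, ∃! p : V × V, p.1 = r - H₂ p.2 ∧ p.2 = H₁ p.1

/-! ### Incremental gain and scaled relative graph -/

section Hilbert

variable {E : Type*} [NormedAddCommGroup E]

/-- The incremental gain `sup ‖y₁ - y₂‖ / ‖u₁ - u₂‖ ∈ [0, ∞]` over all `y₁ ∈ R u₁`, `y₂ ∈ R u₂`.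
In `ℝ≥0∞` one has `0 / 0 = 0` and `a / 0 = ∞` for `a ≠ 0`, so that pairs with `u₁ = u₂` do not
contribute when `R` is single-valued, and the gain of a multi-valued `R` is `∞`. -/
def incGain (R : SetRel E E) : ℝ≥0∞ :=
  ⨆ p ∈ R, ⨆ q ∈ R, ‖p.2 - q.2‖ₑ / ‖p.1 - q.1‖ₑ

variable [InnerProductSpace ℝ E]

/-- The point `(‖y‖ / ‖u‖) exp (± j ∠(u, y))` of the complex plane, with sign `s = ± 1` and with
`∠(u, y) = arccos (⟪u, y⟫ / (‖u‖ ‖y‖)) ∈ [0, π]`. -/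
def srgPoint (s : ℝ) (u y : E) : ℂ :=
  ((‖y‖ / ‖u‖ : ℝ) : ℂ) * Complex.exp (((s * InnerProductGeometry.angle u y : ℝ) : ℂ) * Complex.I)

/-- The scaled relative graph of `R`, a subset of the extended complex plane: the points
`(‖y₁ - y₂‖ / ‖u₁ - u₂‖) exp (± j ∠(u₁ - u₂, y₁ - y₂))` for `u₁ ≠ u₂`, `y₁ ∈ R u₁`, `y₂ ∈ R u₂`,
together with `∞` when `R` is multi-valued. -/
def SRG (R : SetRel E E) : Set (OnePoint ℂ) :=
  {z | ∃ u₁ u₂ y₁ y₂, (u₁, y₁) ∈ R ∧ (u₂, y₂) ∈ R ∧ u₁ ≠ u₂ ∧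
      (z = ↑(srgPoint 1 (u₁ - u₂) (y₁ - y₂)) ∨ z = ↑(srgPoint (-1) (u₁ - u₂) (y₁ - y₂)))} ∪
  {z | z = OnePoint.infty ∧ ∃ u y₁ y₂, (u, y₁) ∈ R ∧ (u, y₂) ∈ R ∧ y₁ ≠ y₂}

end Hilbert

/-- The Möbius inversion `r exp (j ω) ↦ (1 / r) exp (j ω)`, that is `z ↦ 1 / conj z`, of the
extended complex plane; it exchanges `0` and `∞`. -/
def mobiusInv : OnePoint ℂ → OnePoint ℂ
  | OnePoint.infty => ↑(0 : ℂ)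
  | OnePoint.some z => if z = 0 then OnePoint.infty else ↑((starRingEnd ℂ z)⁻¹)

/-- Multiplication of a set of extended complex numbers by a real number (`∞` is kept). -/
def scale (c : ℝ) (A : Set (OnePoint ℂ)) : Set (OnePoint ℂ) :=
  OnePoint.map (fun z : ℂ => (c : ℂ) * z) '' A

/-- `|z - w|` in the extended complex plane, with `|∞ - ∞| = 0`. -/
def extDist : OnePoint ℂ → OnePoint ℂ → ℝ≥0∞
  | OnePoint.infty, OnePoint.infty => 0
  | OnePoint.infty, OnePoint.some _ => ⊤
  | OnePoint.some _, OnePoint.infty => ⊤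
  | OnePoint.some z, OnePoint.some w => ‖z - w‖ₑ

/-- The distance `inf |z - w|` over `z ∈ A`, `w ∈ B`. -/
def setDist (A B : Set (OnePoint ℂ)) : ℝ≥0∞ :=
  ⨅ z ∈ A, ⨅ w ∈ B, extDist z w

/-- The chord property: with every finite point `z`, the set contains the segment `[z, conj z]`. -/
def ChordProperty (A : Set (OnePoint ℂ)) : Prop :=
  ∀ z : ℂ, (z : OnePoint ℂ) ∈ A → ∀ w ∈ segment ℝ z (starRingEnd ℂ z), (w : OnePoint ℂ) ∈ A

/-! ### Signals -/

/-- Lebesgue measure on the time axis `[0, ∞)`. -/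
abbrev timeMeasure : Measure ℝ := volume.restrict (Set.Ici 0)

/-- The real Hilbert space `L₂` of square-integrable signals `[0, ∞) → ℝ`. -/
abbrev L2 : Type := Lp ℝ 2 timeMeasure

/-- Truncation of a signal: `u` on `[0, T]`, and `0` after time `T`. -/
def truncAE (T : ℝ≥0) (u : ℝ →ₘ[timeMeasure] ℝ) : ℝ →ₘ[timeMeasure] ℝ :=
  AEEqFun.mk (Set.indicator (Set.Iic (T : ℝ)) u)
    (u.aestronglyMeasurable.indicator measurableSet_Iic)

theorem coeFn_truncAE (T : ℝ≥0) (u : ℝ →ₘ[timeMeasure] ℝ) :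
    truncAE T u =ᵐ[timeMeasure] Set.indicator (Set.Iic (T : ℝ)) u :=
  AEEqFun.coeFn_mk _ _

theorem truncAE_add (T : ℝ≥0) (u v : ℝ →ₘ[timeMeasure] ℝ) :
    truncAE T (u + v) = truncAE T u + truncAE T v := by
  apply AEEqFun.ext
  filter_upwards [coeFn_truncAE T (u + v), coeFn_truncAE T u, coeFn_truncAE T v,
    AEEqFun.coeFn_add u v, AEEqFun.coeFn_add (truncAE T u) (truncAE T v)] with t h1 h2 h3 h4 h5
  by_cases ht : t ∈ Set.Iic (T : ℝ) <;> simp_all [Set.indicator]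

theorem truncAE_smul (T : ℝ≥0) (c : ℝ) (u : ℝ →ₘ[timeMeasure] ℝ) :
    truncAE T (c • u) = c • truncAE T u := by
  apply AEEqFun.ext
  filter_upwards [coeFn_truncAE T (c • u), coeFn_truncAE T u,
    AEEqFun.coeFn_smul c u, AEEqFun.coeFn_smul c (truncAE T u)] with t h1 h2 h3 h4
  by_cases ht : t ∈ Set.Iic (T : ℝ) <;> simp_all [Set.indicator]

theorem truncAE_mem_Lp (T : ℝ≥0) (u : L2) : truncAE T (u : ℝ →ₘ[timeMeasure] ℝ) ∈
    Lp ℝ 2 timeMeasure := by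
  rw [Lp.mem_Lp_iff_memLp]
  exact (memLp_congr_ae (coeFn_truncAE T _)).2 ((Lp.memLp u).indicator measurableSet_Iic)

/-- The extended space `L₂ₑ`: the signals all of whose truncations are in `L₂`. -/
def L2e : Submodule ℝ (ℝ →ₘ[timeMeasure] ℝ) where
  carrier := {u | ∀ T : ℝ≥0, truncAE T u ∈ Lp ℝ 2 timeMeasure}
  add_mem' := fun {u v} hu hv T => by
    rw [truncAE_add]; exact add_mem (hu T) (hv T)
  zero_mem' := fun T => truncAE_mem_Lp T 0
  smul_mem' := fun c u hu T => by
    rw [truncAE_smul]; exact Lp.const_smul_mem_Lp c ⟨_, hu T⟩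

/-- The inclusion of `L₂` in `L₂ₑ`. -/
def toL2e (u : L2) : L2e := ⟨u, fun T => truncAE_mem_Lp T u⟩

/-- The truncation operator `P_T : L₂ₑ → L₂`. -/
def truncE (T : ℝ≥0) (u : L2e) : L2 := ⟨truncAE T u, u.2 T⟩

/-- The truncation operator `P_T : L₂ → L₂`. -/
def trunc (T : ℝ≥0) (u : L2) : L2 := truncE T (toL2e u)

/-- Causality on `L₂`: `P_T (R u) = P_T (R (P_T u))` for all `u` and `T`. -/
def Causal (R : L2 → L2) : Prop :=
  ∀ (u : L2) (T : ℝ≥0), trunc T (R u) = trunc T (R (trunc T u))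

/-! ### Extension of operators from `L₂` to `L₂ₑ` -/

/-- The signal that at time `t` has the value of `R (P_n u)`, where `n` is the least natural number
with `t ≤ n`. -/
def extendFun (R : L2 → L2) (u : L2e) (t : ℝ) : ℝ := R (truncE (⌈t⌉₊ : ℝ≥0) u) t

theorem measurable_diag {f : ℕ → ℝ → ℝ} (hf : ∀ n, Measurable (f n)) :
    Measurable fun t => f ⌈t⌉₊ t := by
  have h : Measurable fun p : ℕ × ℝ => f p.1 p.2 := measurable_from_prod_countable_right hf
  exact h.comp (Nat.measurable_ceil.prodMk measurable_id)

theorem measurable_extendFun (R : L2 → L2) (u : L2e) : Measurable (extendFun R u) :=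
  measurable_diag (f := fun n t => R (truncE (n : ℝ≥0) u) t)
    fun n => (Lp.stronglyMeasurable (R (truncE (n : ℝ≥0) u))).measurable

theorem memLp_extendFun (R : L2 → L2) (u : L2e) (T : ℝ≥0) :
    MemLp (Set.indicator (Set.Iic (T : ℝ)) (extendFun R u)) 2 timeMeasure := by
  have hsum : MemLp (fun t => ∑ n ∈ Finset.range (⌈(T : ℝ)⌉₊ + 1),
      ‖R (truncE (n : ℝ≥0) u) t‖) 2 timeMeasure :=
    memLp_finsetSum _ fun n _ => (Lp.memLp _).norm
  refine hsum.mono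
    ((measurable_extendFun R u).indicator measurableSet_Iic).aestronglyMeasurable
    (Filter.Eventually.of_forall fun t => ?_)
  rw [Real.norm_of_nonneg (Finset.sum_nonneg fun n _ => norm_nonneg _)]
  by_cases ht : t ∈ Set.Iic (T : ℝ)
  · rw [Set.indicator_of_mem ht]
    exact Finset.single_le_sum (f := fun n : ℕ => ‖R (truncE (n : ℝ≥0) u) t‖)
      (fun n _ => norm_nonneg _)
      (Finset.mem_range.2 (Nat.lt_succ_of_le (Nat.ceil_mono ht)))
  · rw [Set.indicator_of_notMem ht, norm_zero]
    exact Finset.sum_nonneg fun n _ => norm_nonneg _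

/-- The extension to `L₂ₑ` of a causal operator `R` on `L₂`. It is the operator with
`P_T (extend R u) = P_T (R (P_T u))` for all `T`, see `truncE_extend` and `eq_extend`. -/
def extend (R : L2 → L2) (u : L2e) : L2e :=
  ⟨AEEqFun.mk (extendFun R u) (measurable_extendFun R u).aestronglyMeasurable, fun T => by
    rw [Lp.mem_Lp_iff_memLp]
    refine (memLp_congr_ae ?_).2 (memLp_extendFun R u T)
    refine (coeFn_truncAE T _).trans ?_
    filter_upwards [AEEqFun.coeFn_mk (extendFun R u)
      (measurable_extendFun R u).aestronglyMeasurable] with t ht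
    by_cases h : t ∈ Set.Iic (T : ℝ)
    · rw [Set.indicator_of_mem h, Set.indicator_of_mem h, ht]
    · rw [Set.indicator_of_notMem h, Set.indicator_of_notMem h]⟩

theorem truncE_coe (T : ℝ≥0) (u : L2e) :
    truncE T u =ᵐ[timeMeasure] Set.indicator (Set.Iic (T : ℝ)) u :=
  coeFn_truncAE T _

theorem trunc_coe (T : ℝ≥0) (u : L2) :
    trunc T u =ᵐ[timeMeasure] Set.indicator (Set.Iic (T : ℝ)) u :=
  coeFn_truncAE T _

theorem trunc_truncE {S T : ℝ≥0} (h : S ≤ T) (u : L2e) :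
    trunc S (truncE T u) = truncE S u := by
  apply Lp.ext
  filter_upwards [trunc_coe S (truncE T u), truncE_coe S u, truncE_coe T u] with t h1 h2 h3
  rw [h1, h2]
  by_cases ht : t ∈ Set.Iic (S : ℝ)
  · have ht' : t ∈ Set.Iic (T : ℝ) := le_trans ht (NNReal.coe_le_coe.2 h)
    rw [Set.indicator_of_mem ht, Set.indicator_of_mem ht, h3, Set.indicator_of_mem ht']
  · rw [Set.indicator_of_notMem ht, Set.indicator_of_notMem ht]

theorem truncE_extend {R : L2 → L2} (hR : Causal R) (u : L2e) (T : ℝ≥0) :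
    truncE T (extend R u) = trunc T (R (truncE T u)) := by
  have key : ∀ n : ℕ, trunc (min (n : ℝ≥0) T) (R (truncE (n : ℝ≥0) u)) =
      trunc (min (n : ℝ≥0) T) (R (truncE T u)) := fun n => by
    rw [hR (truncE (n : ℝ≥0) u), hR (truncE T u), trunc_truncE (min_le_left _ _),
      trunc_truncE (min_le_right _ _)]
  have hall : ∀ᵐ t ∂timeMeasure, ∀ n : ℕ, t ∈ Set.Iic ((min (n : ℝ≥0) T : ℝ≥0) : ℝ) →
      R (truncE (n : ℝ≥0) u) t = R (truncE T u) t := by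
    rw [ae_all_iff]
    intro n
    have h0 := trunc_coe (min (n : ℝ≥0) T) (R (truncE (n : ℝ≥0) u))
    rw [key n] at h0
    filter_upwards [h0, trunc_coe (min (n : ℝ≥0) T) (R (truncE T u))] with t h1 h2 ht
    rw [Set.indicator_of_mem ht] at h1 h2
    rw [← h1, h2]
  apply Lp.ext
  filter_upwards [truncE_coe T (extend R u), trunc_coe T (R (truncE T u)), hall,
    AEEqFun.coeFn_mk (extendFun R u) (measurable_extendFun R u).aestronglyMeasurable]
    with t h1 h2 h3 h4
  rw [h1, h2]
  by_cases ht : t ∈ Set.Iic (T : ℝ)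
  · rw [Set.indicator_of_mem ht, Set.indicator_of_mem ht]
    refine h4.trans (h3 ⌈t⌉₊ ?_)
    simpa [NNReal.coe_min] using And.intro (Nat.le_ceil t) ht
  · rw [Set.indicator_of_notMem ht, Set.indicator_of_notMem ht]

theorem L2e_ext {u v : L2e} (h : ∀ T : ℝ≥0, truncE T u = truncE T v) : u = v := by
  apply Subtype.ext
  apply AEEqFun.ext
  have hall : ∀ᵐ t ∂timeMeasure, ∀ n : ℕ, t ∈ Set.Iic (((n : ℝ≥0)) : ℝ) →
      (u : ℝ →ₘ[timeMeasure] ℝ) t = (v : ℝ →ₘ[timeMeasure] ℝ) t := by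
    rw [ae_all_iff]
    intro n
    have h0 := truncE_coe (n : ℝ≥0) u
    rw [h] at h0
    filter_upwards [h0, truncE_coe (n : ℝ≥0) v] with t h1 h2 ht
    rw [Set.indicator_of_mem ht] at h1 h2
    rw [← h1, h2]
  filter_upwards [hall] with t ht
  exact ht ⌈t⌉₊ (by simpa using Nat.le_ceil t)

theorem eq_extend {R : L2 → L2} (hR : Causal R) (R' : L2e → L2e)
    (h : ∀ (u : L2e) (T : ℝ≥0), truncE T (R' u) = trunc T (R (truncE T u))) :
    R' = extend R :=
  funext fun u => L2e_ext fun T => (h u T).trans (truncE_extend hR u T).symm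

end ScaledRelativeGraph

end

namespace ScaledRelativeGraph

open InnerProductGeometry

/-! ### The incremental bound from the separation of scaled relative graphs -/

section Inner

variable {E : Type*} [NormedAddCommGroup E]

/-! For two solutions at loop gain `τ`, let `e`, `y`, `w` be the differences of the inputs of `H₁`,
its outputs, and the outputs of `H₂`. Both graphs are symmetric under conjugation, so one may
compare the points at angles `∠(e, y)` and `-∠(y, w)`. Their separation, times `‖y‖`, is the length
of `e + τ w` laid out in a plane with `∠(e, y) + ∠(y, w)` between the two vectors. By the triangle
inequality for angles this is at most the true `‖e + τ w‖`, whence `r_m ‖y‖ ≤ ‖e + τ w‖`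
(`norm_sub_le_of_le_setDist`).

The closed loop at every gain in `[0, 1]` is thus `1 / r_m`-Lipschitz wherever it exists. Since this
bound does not degrade with `τ`, Banach's theorem continues the solution from `τ = 0` to `τ = 1` in
finitely many equal steps (`exists_isClosedLoop_one`). Causality survives each step, because
truncated outputs solve a contractive equation of their own, and it transfers well-posedness to
`L2e` one time window at a time. -/

theorem norm_sub_le_of_incGain {H : E → E} (hH : incGain (Function.graph H) < ⊤) (u v : E) :
    ‖H u - H v‖ ≤ (incGain (Function.graph H)).toReal * ‖u - v‖ := by
  rcases eq_or_ne u v with rfl | huv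
  · simp
  have h : ‖H u - H v‖ₑ / ‖u - v‖ₑ ≤ incGain (Function.graph H) := by
    unfold incGain
    exact le_iSup₂_of_le (u, H u) rfl (le_iSup₂_of_le (v, H v) rfl le_rfl)
  have h' : ‖H u - H v‖ₑ ≤ incGain (Function.graph H) * ‖u - v‖ₑ :=
    (ENNReal.div_le_iff (by simpa [sub_eq_zero] using huv) enorm_ne_top).1 h
  have := ENNReal.toReal_mono (ENNReal.mul_ne_top hH.ne enorm_ne_top) h'
  simpa [ENNReal.toReal_mul] using this

theorem incGain_graph_le {H : E → E} {K : ℝ} (h : ∀ u v, ‖H u - H v‖ ≤ K * ‖u - v‖) :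
    incGain (Function.graph H) ≤ ENNReal.ofReal K := by
  unfold incGain
  refine iSup₂_le fun p hp => iSup₂_le fun q hq => ?_
  obtain ⟨u, _⟩ := p
  obtain ⟨v, _⟩ := q
  obtain rfl : H u = _ := hp
  obtain rfl : H v = _ := hq
  rcases eq_or_ne u v with rfl | huv
  · simp
  rw [ENNReal.div_le_iff (by simpa [sub_eq_zero] using huv) enorm_ne_top]
  have hpos : 0 < ‖u - v‖ := norm_pos_iff.2 (sub_ne_zero.2 huv)
  have hK : 0 ≤ K := nonneg_of_mul_nonneg_left ((norm_nonneg _).trans (h u v)) hpos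
  rw [← ofReal_norm, ← ofReal_norm, ← ENNReal.ofReal_mul hK]
  exact ENNReal.ofReal_le_ofReal (h u v)

variable [InnerProductSpace ℝ E]

/-- The triangle inequality for angles suffices while the sum is at most `π`. Beyond that, the same
inequality through `-y` gives `∠(x, z) ≤ 2π - (∠(x, y) + ∠(y, z))`. -/
theorem cos_angle_add_angle_le (x y z : E) :
    Real.cos (angle x y + angle y z) ≤ Real.cos (angle x z) := by
  rcases le_total (angle x y + angle y z) Real.pi with h | h
  · exact Real.cos_le_cos_of_nonneg_of_le_pi (angle_nonneg _ _) h (angle_le_angle_add_angle x y z)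
  · have h1 := angle_le_angle_add_angle x (-y) z
    rw [angle_neg_right, angle_neg_left] at h1
    rw [← Real.cos_two_pi_sub]
    exact Real.cos_le_cos_of_nonneg_of_le_pi (angle_nonneg _ _) (by linarith) (by linarith)

/-- Inversion keeps the argument and inverts the modulus, while the angle is symmetric, so input and
output trade places. -/
theorem mobiusInv_srgPoint (s : ℝ) {u y : E} (hu : u ≠ 0) (hy : y ≠ 0) :
    mobiusInv (srgPoint s u y : ℂ) = ((srgPoint s y u : ℂ) : OnePoint ℂ) := by
  have h0 : srgPoint s u y ≠ 0 := by
    simp [srgPoint, hu, hy]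
  have h1 : mobiusInv (srgPoint s u y : ℂ) =
      (((starRingEnd ℂ (srgPoint s u y))⁻¹ : ℂ) : OnePoint ℂ) := if_neg h0
  rw [h1]
  congr 1
  simp only [srgPoint, map_mul, Complex.conj_ofReal, ← Complex.exp_conj, Complex.conj_I, mul_inv,
    ← Complex.exp_neg, angle_comm y u]
  push_cast
  rw [inv_div]
  congr 2
  ring

theorem norm_srgPoint_add_le {y : E} (hy : y ≠ 0) (e w : E) {τ : ℝ} (hτ : 0 ≤ τ) :
    ‖srgPoint 1 y e + τ * srgPoint (-1) y w‖ * ‖y‖ ≤ ‖e + τ • w‖ := by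
  have hy' : ‖y‖ ≠ 0 := norm_ne_zero_iff.2 hy
  set α := angle e y with hα
  set β := angle y w with hβ
  have hre : (srgPoint 1 y e + τ * srgPoint (-1) y w).re =
      (‖e‖ * Real.cos α + τ * ‖w‖ * Real.cos β) / ‖y‖ := by
    simp only [srgPoint, angle_comm y e, ← hα, ← hβ, Complex.add_re,
      Complex.re_ofReal_mul, Complex.exp_ofReal_mul_I_re, one_mul, neg_mul, Real.cos_neg]
    ring
  have him : (srgPoint 1 y e + τ * srgPoint (-1) y w).im =
      (‖e‖ * Real.sin α - τ * ‖w‖ * Real.sin β) / ‖y‖ := by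
    simp only [srgPoint, angle_comm y e, ← hα, ← hβ, Complex.add_im,
      Complex.im_ofReal_mul, Complex.exp_ofReal_mul_I_im, one_mul, neg_mul, Real.sin_neg]
    ring
  refine le_of_sq_le_sq ?_ (norm_nonneg _)
  have hcos := cos_angle_add_angle_le e y w
  rw [← hα, ← hβ, Real.cos_add] at hcos
  have hmul := mul_le_mul_of_nonneg_left hcos
    (mul_nonneg hτ (mul_nonneg (norm_nonneg e) (norm_nonneg w)))
  have hin := cos_angle_mul_norm_mul_norm e w
  rw [mul_pow, Complex.sq_norm, Complex.normSq_apply, hre, him, norm_add_sq_real, norm_smul,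
    real_inner_smul_right, Real.norm_of_nonneg hτ, ← hin]
  have hcs := Real.sin_sq_add_cos_sq α
  have hcs' := Real.sin_sq_add_cos_sq β
  field_simp
  -- By Pythagoras the left side is `‖e‖² + 2τ‖e‖‖w‖ cos (α + β) + τ²‖w‖²`; `hmul` compares the
  -- cross terms.
  nlinarith [congrArg (‖e‖ ^ 2 * ·) hcs, congrArg (τ ^ 2 * ‖w‖ ^ 2 * ·) hcs']

/-- If `SRG(H₁)⁻¹` and `-τ SRG(H₂)` are `c` apart, then `(H₁⁻¹ + τ H₂)⁻¹` has incremental gain at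
most `1 / c`. -/
theorem norm_sub_le_of_le_setDist {H₁ H₂ : E → E} {c τ : ℝ} (hτ : 0 ≤ τ)
    (h : ENNReal.ofReal c ≤ setDist (mobiusInv '' SRG (Function.graph H₁))
      (scale (-τ) (SRG (Function.graph H₂)))) (e₁ e₂ : E) :
    c * ‖H₁ e₁ - H₁ e₂‖ ≤ ‖(e₁ + τ • H₂ (H₁ e₁)) - (e₂ + τ • H₂ (H₁ e₂))‖ := by
  rcases eq_or_ne (H₁ e₁) (H₁ e₂) with hy | hy
  · simp [hy]
  have he : e₁ ≠ e₂ := fun he => hy (congrArg H₁ he)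
  have hy0 := sub_ne_zero.2 hy
  set y := H₁ e₁ - H₁ e₂
  set w := H₂ (H₁ e₁) - H₂ (H₁ e₂) with hw
  -- Opposite signs in `hz` and `hv` make the two angles add up in the plane.
  have hz : ((srgPoint 1 y (e₁ - e₂) : ℂ) : OnePoint ℂ) ∈ mobiusInv '' SRG (Function.graph H₁) :=
    ⟨_, Or.inl ⟨e₁, e₂, H₁ e₁, H₁ e₂, rfl, rfl, he, Or.inl rfl⟩,
      mobiusInv_srgPoint 1 (sub_ne_zero.2 he) hy0⟩
  have hv : ((((-τ : ℝ) : ℂ) * srgPoint (-1) y w : ℂ) : OnePoint ℂ) ∈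
      scale (-τ) (SRG (Function.graph H₂)) :=
    ⟨_, Or.inl ⟨H₁ e₁, H₁ e₂, _, _, rfl, rfl, hy, Or.inr rfl⟩, rfl⟩
  have hd : ENNReal.ofReal c ≤
      ‖srgPoint 1 y (e₁ - e₂) - ((-τ : ℝ) : ℂ) * srgPoint (-1) y w‖ₑ := by
    refine h.trans ?_
    unfold setDist
    exact (iInf₂_le _ hz).trans (iInf₂_le _ hv)
  rw [← ofReal_norm, ENNReal.ofReal_le_ofReal_iff (norm_nonneg _)] at hd
  have hsplit : (e₁ + τ • H₂ (H₁ e₁)) - (e₂ + τ • H₂ (H₁ e₂)) = (e₁ - e₂) + τ • w := by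
    rw [hw, smul_sub]; abel
  rw [hsplit]
  refine (mul_le_mul_of_nonneg_right hd (norm_nonneg _)).trans ?_
  simpa [sub_neg_eq_add] using norm_srgPoint_add_le hy0 (e₁ - e₂) w hτ

end Inner

/-! ### Continuation in the loop gain -/

section Continuation

variable {E : Type*} [NormedAddCommGroup E] [NormedSpace ℝ E]

/-- `T` is the closed-loop map `(H₁⁻¹ + τ H₂)⁻¹`, up to uniqueness of solutions. -/
def IsClosedLoop (H₁ H₂ : E → E) (τ : ℝ) (T : E → E) : Prop :=
  ∀ r, ∃ e, T r = H₁ e ∧ e + τ • H₂ (T r) = r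

theorem IsClosedLoop.norm_sub_le {H₁ H₂ T : E → E} {τ c : ℝ} (hc : 0 < c)
    (hT : IsClosedLoop H₁ H₂ τ T)
    (h : ∀ e₁ e₂, c * ‖H₁ e₁ - H₁ e₂‖ ≤ ‖(e₁ + τ • H₂ (H₁ e₁)) - (e₂ + τ • H₂ (H₁ e₂))‖)
    (r₁ r₂ : E) : ‖T r₁ - T r₂‖ ≤ 1 / c * ‖r₁ - r₂‖ := by
  obtain ⟨e₁, h₁, h₁'⟩ := hT r₁
  obtain ⟨e₂, h₂, h₂'⟩ := hT r₂
  have := h e₁ e₂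
  rw [← h₁, ← h₂, h₁', h₂'] at this
  rw [one_div, inv_mul_eq_div, le_div_iff₀ hc]
  linarith

/-- The extra feedback `δ H₂` is absorbed into the input of the loop at gain `τ`. -/
theorem IsClosedLoop.step {H₁ H₂ T T' : E → E} {τ δ : ℝ} (hT : IsClosedLoop H₁ H₂ τ T)
    (h : ∀ r, T' r = T (r - δ • H₂ (T' r))) : IsClosedLoop H₁ H₂ (τ + δ) T' := fun r => by
  obtain ⟨e, he, he'⟩ := hT (r - δ • H₂ (T' r))
  rw [← h] at he he'
  exact ⟨e, he, by rw [add_smul, ← add_assoc, he', sub_add_cancel]⟩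

variable [CompleteSpace E]

theorem exists_forall_eq_apply_sub_smul {T H : E → E} {M L δ : ℝ}
    (hT : ∀ u v, ‖T u - T v‖ ≤ M * ‖u - v‖) (hH : ∀ u v, ‖H u - H v‖ ≤ L * ‖u - v‖)
    (hM : 0 ≤ M) (hL : 0 ≤ L) (hδ : 0 ≤ δ) (h1 : M * (δ * L) < 1) :
    ∃ T' : E → E, ∀ r, T' r = T (r - δ • H (T' r)) := by
  have key : ∀ r, ∃ y, y = T (r - δ • H y) := fun r => by
    have hc : ContractingWith ⟨M * (δ * L), by positivity⟩ fun y => T (r - δ • H y) := by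
      refine ⟨h1, LipschitzWith.of_dist_le_mul fun u v => ?_⟩
      rw [dist_eq_norm, dist_eq_norm]
      calc ‖T (r - δ • H u) - T (r - δ • H v)‖
          ≤ M * ‖(r - δ • H u) - (r - δ • H v)‖ := hT _ _
        _ = M * (δ * ‖H u - H v‖) := by
          rw [sub_sub_sub_cancel_left, ← smul_sub, norm_smul, Real.norm_of_nonneg hδ, norm_sub_rev]
        _ ≤ M * (δ * (L * ‖u - v‖)) := by gcongr; exact hH u v
        _ = M * (δ * L) * ‖u - v‖ := by ring
    exact ⟨_, hc.fixedPoint_isFixedPt.symm⟩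
  choose T' hT' using key
  exact ⟨T', hT'⟩

/-- A property of the closed-loop map that holds for zero loop gain and is inherited by sufficiently
short continuation steps holds for full loop gain. -/
theorem exists_isClosedLoop_one {H₁ H₂ : E → E} {L c : ℝ} (hc : 0 < c) (hL : 0 ≤ L)
    (hH₂ : ∀ u v, ‖H₂ u - H₂ v‖ ≤ L * ‖u - v‖)
    (h : ∀ τ ∈ Set.Icc (0 : ℝ) 1, ∀ e₁ e₂,
      c * ‖H₁ e₁ - H₁ e₂‖ ≤ ‖(e₁ + τ • H₂ (H₁ e₁)) - (e₂ + τ • H₂ (H₁ e₂))‖)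
    {P : (E → E) → Prop} (h0 : P H₁)
    (hP : ∀ (T T' : E → E) (δ : ℝ), 0 ≤ δ → 1 / c * (δ * L) < 1 →
      (∀ u v, ‖T u - T v‖ ≤ 1 / c * ‖u - v‖) → (∀ r, T' r = T (r - δ • H₂ (T' r))) →
      P T → P T') :
    ∃ T, IsClosedLoop H₁ H₂ 1 T ∧ P T := by
  -- With `n > L / c` each step of length `1 / n` has contraction constant `L / (c n) < 1`, whatever
  -- the current gain.
  obtain ⟨n, hn⟩ := exists_nat_gt (L / c)
  have hn0 : (0 : ℝ) < n := (div_nonneg hL hc.le).trans_lt hn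
  have hδ : (0 : ℝ) ≤ 1 / n := by positivity
  have hsmall : 1 / c * (1 / n * L) < 1 := by
    rw [show 1 / c * (1 / n * L) = (L / c) / n by field_simp, div_lt_one hn0]
    exact hn
  have key : ∀ k : ℕ, k ≤ n → ∃ T, IsClosedLoop H₁ H₂ (k / n) T ∧ P T := fun k => by
    induction k with
    | zero => exact fun _ => ⟨H₁, fun r => ⟨r, rfl, by simp⟩, h0⟩
    | succ k ih =>
      intro hk
      obtain ⟨T, hT, hPT⟩ := ih (Nat.le_of_succ_le hk)
      have hmem : (k / n : ℝ) ∈ Set.Icc (0 : ℝ) 1 :=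
        ⟨by positivity, (div_le_one hn0).2 (by exact_mod_cast Nat.le_of_succ_le hk)⟩
      have hlip := hT.norm_sub_le hc (h _ hmem)
      obtain ⟨T', hT'⟩ :=
        exists_forall_eq_apply_sub_smul hlip hH₂ (by positivity) hL hδ hsmall
      refine ⟨T', ?_, hP T T' _ hδ hsmall hlip hT' hPT⟩
      have := hT.step hT'
      rwa [← add_div, ← Nat.cast_succ] at this
  simpa [div_self hn0.ne'] using key n le_rfl

end Continuation

/-! ### Uniqueness and relational forms of the closed loop at full gain -/

section ClosedLoop

variable {E : Type*} [NormedAddCommGroup E] [NormedSpace ℝ E] {H₁ H₂ T : E → E}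

/-- Only the output needs to be determined by `r`; then `e = r - H₂ y` follows. -/
theorem IsClosedLoop.eq_of_add_eq (hT : IsClosedLoop H₁ H₂ 1 T)
    (h : ∀ e₁ e₂, e₁ + H₂ (H₁ e₁) = e₂ + H₂ (H₁ e₂) → H₁ e₁ = H₁ e₂) {e r : E}
    (he : e + H₂ (H₁ e) = r) : T r = H₁ e := by
  obtain ⟨e', h₁, h₂⟩ := hT r
  rw [h₁, one_smul] at h₂
  rw [h₁]
  exact h _ _ (h₂.trans he.symm)

theorem IsClosedLoop.wellPosed (hT : IsClosedLoop H₁ H₂ 1 T)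
    (h : ∀ e₁ e₂, e₁ + H₂ (H₁ e₁) = e₂ + H₂ (H₁ e₂) → H₁ e₁ = H₁ e₂) :
    WellPosed Set.univ H₁ H₂ := fun r _ => by
  obtain ⟨e, h₁, h₂⟩ := hT r
  rw [one_smul] at h₂
  refine ⟨(e, T r), ⟨eq_sub_of_add_eq h₂, h₁⟩, ?_⟩
  rintro ⟨e', y'⟩ ⟨h₃, h₄⟩
  dsimp only at h₃ h₄
  have hy : T r = y' := by
    rw [h₄]
    exact hT.eq_of_add_eq h (by rw [← h₄]; exact eq_sub_iff_add_eq.1 h₃)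
  rw [Prod.mk.injEq]
  exact ⟨by rw [h₃, ← hy]; exact sub_eq_of_eq_add h₂.symm, hy.symm⟩

theorem IsClosedLoop.graph_eq_feedback (hT : IsClosedLoop H₁ H₂ 1 T)
    (h : ∀ e₁ e₂, e₁ + H₂ (H₁ e₁) = e₂ + H₂ (H₁ e₂) → H₁ e₁ = H₁ e₂) :
    Function.graph T = feedback H₁ H₂ := by
  ext ⟨r, y⟩
  constructor
  · intro hy
    obtain rfl : T r = y := hy
    obtain ⟨e, h₁, h₂⟩ := hT r
    rw [one_smul] at h₂
    exact ⟨e, H₂ (T r), h₁.symm, rfl, h₂.symm⟩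
  · rintro ⟨e, z, h₁, h₂, h₃⟩
    obtain rfl : H₁ e = y := h₁
    obtain rfl : H₂ (H₁ e) = z := h₂
    exact hT.eq_of_add_eq h h₃.symm

theorem IsClosedLoop.graph_eq_feedback' (hT : IsClosedLoop H₁ H₂ 1 T)
    (h : ∀ e₁ e₂, e₁ + H₂ (H₁ e₁) = e₂ + H₂ (H₁ e₂) → H₁ e₁ = H₁ e₂) :
    Function.graph T = feedback' H₁ H₂ := by
  ext ⟨r, y⟩
  constructor
  · intro hy
    obtain rfl : T r = y := hy
    obtain ⟨e, h₁, h₂⟩ := hT r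
    rw [one_smul, h₁] at h₂
    exact ⟨e, ⟨e, H₂ (H₁ e), rfl, ⟨H₁ e, rfl, rfl⟩, h₂.symm⟩, h₁.symm⟩
  · rintro ⟨e, ⟨e', z, h₀, ⟨y', h₁, h₂⟩, h₃⟩, h₄⟩
    obtain rfl : e = e' := h₀
    obtain rfl : H₁ e = y' := h₁
    obtain rfl : H₂ (H₁ e) = z := h₂
    obtain rfl : H₁ e = y := h₄
    exact hT.eq_of_add_eq h h₃.symm

end ClosedLoop

/-! ### Truncation and causality -/

theorem truncE_add (T : ℝ≥0) (u v : L2e) : truncE T (u + v) = truncE T u + truncE T v :=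
  Subtype.ext (truncAE_add T u v)

theorem truncE_smul (T : ℝ≥0) (c : ℝ) (u : L2e) : truncE T (c • u) = c • truncE T u :=
  Subtype.ext (truncAE_smul T c u)

theorem truncE_sub (T : ℝ≥0) (u v : L2e) : truncE T (u - v) = truncE T u - truncE T v := by
  rw [eq_sub_iff_add_eq, ← truncE_add, sub_add_cancel]

theorem trunc_add (T : ℝ≥0) (u v : L2) : trunc T (u + v) = trunc T u + trunc T v :=
  truncE_add T (toL2e u) (toL2e v)

theorem trunc_sub (T : ℝ≥0) (u v : L2) : trunc T (u - v) = trunc T u - trunc T v := by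
  rw [eq_sub_iff_add_eq, ← trunc_add, sub_add_cancel]

theorem trunc_smul (T : ℝ≥0) (c : ℝ) (u : L2) : trunc T (c • u) = c • trunc T u :=
  truncE_smul T c (toL2e u)

theorem trunc_trunc (T : ℝ≥0) (u : L2) : trunc T (trunc T u) = trunc T u :=
  trunc_truncE le_rfl (toL2e u)

theorem norm_trunc_le (T : ℝ≥0) (u : L2) : ‖trunc T u‖ ≤ ‖u‖ := by
  refine Lp.norm_le_norm_of_ae_le ?_
  filter_upwards [trunc_coe T u] with t ht
  rw [ht]
  exact norm_indicator_le_norm_self _ _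

/-- Causality is inherited by the solution map of a contractive feedback equation. -/
theorem Causal.of_eq_apply_sub_smul {T T' H : L2 → L2} {M L δ : ℝ} (hT : Causal T)
    (hH : Causal H) (hTL : ∀ u v, ‖T u - T v‖ ≤ M * ‖u - v‖)
    (hHL : ∀ u v, ‖H u - H v‖ ≤ L * ‖u - v‖) (hM : 0 ≤ M) (hδ : 0 ≤ δ)
    (h1 : M * (δ * L) < 1) (h : ∀ r, T' r = T (r - δ • H (T' r))) : Causal T' := fun r S => by
  -- Causality of `T` and `H` closes the equation on the window `[0, S]`: only truncated signals
  -- enter.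
  have key : ∀ r, trunc S (T' r) =
      trunc S (T (trunc S r - δ • trunc S (H (trunc S (T' r))))) := fun r => by
    conv_lhs => rw [h, hT, trunc_sub, trunc_smul, hH]
  -- The inputs `r` and `trunc S r` give the same truncated equation, whose contraction constant is
  -- below `1`.
  have hle : ‖trunc S (T' r) - trunc S (T' (trunc S r))‖ ≤
      M * (δ * L) * ‖trunc S (T' r) - trunc S (T' (trunc S r))‖ := by
    set a := trunc S (T' r) with ha
    set b := trunc S (T' (trunc S r)) with hb
    have ha' : a = trunc S (T (trunc S r - δ • trunc S (H a))) := key r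
    have hb' : b = trunc S (T (trunc S r - δ • trunc S (H b))) := by
      have := key (trunc S r)
      rwa [trunc_trunc] at this
    calc ‖a - b‖ = ‖trunc S (T (trunc S r - δ • trunc S (H a)) -
            T (trunc S r - δ • trunc S (H b)))‖ := by rw [trunc_sub, ← ha', ← hb']
      _ ≤ ‖T (trunc S r - δ • trunc S (H a)) - T (trunc S r - δ • trunc S (H b))‖ :=
        norm_trunc_le _ _
      _ ≤ M * ‖(trunc S r - δ • trunc S (H a)) - (trunc S r - δ • trunc S (H b))‖ := hTL _ _
      _ = M * (δ * ‖trunc S (H a - H b)‖) := by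
        rw [sub_sub_sub_cancel_left, ← smul_sub, norm_smul, Real.norm_of_nonneg hδ, norm_sub_rev,
          trunc_sub]
      _ ≤ M * (δ * (L * ‖a - b‖)) := by
        gcongr
        exact (norm_trunc_le _ _).trans (hHL a b)
      _ = M * (δ * L) * ‖a - b‖ := by ring
  refine sub_eq_zero.1 (norm_le_zero_iff.1 ?_)
  by_contra hpos
  nlinarith [not_le.1 hpos]

theorem extend_toL2e {R : L2 → L2} (hR : Causal R) (u : L2) :
    extend R (toL2e u) = toL2e (R u) :=
  L2e_ext fun T => (truncE_extend hR _ T).trans (hR u T).symm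

/-- A causal closed loop that is well-posed on `L₂` is well-posed on `L₂ₑ`. -/
theorem IsClosedLoop.wellPosed_extend {H₁ H₂ T : L2 → L2} (hT : IsClosedLoop H₁ H₂ 1 T)
    (h : ∀ e₁ e₂, e₁ + H₂ (H₁ e₁) = e₂ + H₂ (H₁ e₂) → H₁ e₁ = H₁ e₂)
    (h₁ : Causal H₁) (h₂ : Causal H₂) (hc : Causal T) :
    WellPosed (Set.range toL2e) (extend H₁) (extend H₂) := by
  rintro _ ⟨r, rfl⟩
  obtain ⟨e, he, he'⟩ := hT r
  rw [one_smul] at he'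
  refine ⟨(toL2e e, toL2e (T r)), ⟨?_, ?_⟩, ?_⟩
  · dsimp only
    rw [extend_toL2e h₂, eq_sub_iff_add_eq]
    exact Subtype.ext (congrArg (Subtype.val ∘ toL2e) he')
  · dsimp only
    rw [extend_toL2e h₁, he]
  rintro ⟨e', y'⟩ ⟨h₃, h₄⟩
  dsimp only at h₃ h₄
  have hy : y' = toL2e (T r) := L2e_ext fun S => by
    have hyS : truncE S y' = trunc S (H₁ (truncE S e')) := by
      rw [h₄, truncE_extend h₁]
    have heS : truncE S e' + trunc S (H₂ (truncE S y')) = trunc S r := by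
      rw [h₃, truncE_sub, truncE_extend h₂]
      exact sub_add_cancel _ _
    -- `truncE S e'` solves the `L2` loop exactly for an input that may differ from `r` only after
    -- time `S`; causality of `T` ignores that difference.
    have hr : trunc S (truncE S e' + H₂ (H₁ (truncE S e'))) = trunc S r := by
      rw [trunc_add, trunc_truncE le_rfl, h₂, ← hyS, heS]
    rw [hyS, ← hT.eq_of_add_eq h rfl, hc, hr, ← hc]
    rfl
  rw [Prod.mk.injEq]
  refine ⟨?_, hy⟩
  rw [h₃, hy, extend_toL2e h₂, sub_eq_iff_eq_add]
  exact Subtype.ext (congrArg (Subtype.val ∘ toL2e) he'.symm)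

end ScaledRelativeGraph

theorem mainTheorem7
    (H₁ H₂ : ScaledRelativeGraph.L2 → ScaledRelativeGraph.L2)
    (hH₁ : ScaledRelativeGraph.incGain (Function.graph H₁) < ⊤)
    (hH₂ : ScaledRelativeGraph.incGain (Function.graph H₂) < ⊤)
    (r_m : ℝ) (hr_m : 0 < r_m)
    (hdist : ∀ τ ∈ Set.Icc (0 : ℝ) 1,
      ENNReal.ofReal r_m ≤ ScaledRelativeGraph.setDist
        (ScaledRelativeGraph.mobiusInv '' ScaledRelativeGraph.SRG (Function.graph H₁))
        (ScaledRelativeGraph.scale (-τ) (ScaledRelativeGraph.SRG (Function.graph H₂))))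
    (hchord : ScaledRelativeGraph.ChordProperty (ScaledRelativeGraph.SRG (Function.graph H₁)) ∨
      ScaledRelativeGraph.ChordProperty (ScaledRelativeGraph.SRG (Function.graph H₂))) :
    ScaledRelativeGraph.WellPosed Set.univ H₁ H₂ ∧
    ∃ T : ScaledRelativeGraph.L2 → ScaledRelativeGraph.L2,
      Function.graph T = ScaledRelativeGraph.feedback H₁ H₂ ∧
      Function.graph T = ScaledRelativeGraph.feedback' H₁ H₂ ∧
      ScaledRelativeGraph.incGain (Function.graph T) ≤ ENNReal.ofReal (1 / r_m) ∧
      (ScaledRelativeGraph.Causal H₁ → ScaledRelativeGraph.Causal H₂ →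
        ScaledRelativeGraph.Causal T ∧
        ScaledRelativeGraph.WellPosed (Set.range ScaledRelativeGraph.toL2e)
          (ScaledRelativeGraph.extend H₁) (ScaledRelativeGraph.extend H₂)) := by
  have hbound : ∀ τ ∈ Set.Icc (0 : ℝ) 1, ∀ e₁ e₂, r_m * ‖H₁ e₁ - H₁ e₂‖ ≤
      ‖(e₁ + τ • H₂ (H₁ e₁)) - (e₂ + τ • H₂ (H₁ e₂))‖ :=
    fun τ hτ => ScaledRelativeGraph.norm_sub_le_of_le_setDist hτ.1 (hdist τ hτ)
  have hinj : ∀ e₁ e₂, e₁ + H₂ (H₁ e₁) = e₂ + H₂ (H₁ e₂) → H₁ e₁ = H₁ e₂ := fun e₁ e₂ h => by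
    have := hbound 1 ⟨zero_le_one, le_rfl⟩ e₁ e₂
    rw [one_smul, one_smul, h, sub_self, norm_zero] at this
    exact sub_eq_zero.1 (norm_le_zero_iff.1 (nonpos_of_mul_nonpos_right this hr_m))
  have hL := ScaledRelativeGraph.norm_sub_le_of_incGain hH₂
  obtain ⟨T, hT, hcausal⟩ := ScaledRelativeGraph.exists_isClosedLoop_one hr_m
    ENNReal.toReal_nonneg hL hbound
    -- Stating causality as an implication lets a single `T` serve both the general and the causal
    -- claims.
    (P := fun T => ScaledRelativeGraph.Causal H₁ → ScaledRelativeGraph.Causal H₂ →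
      ScaledRelativeGraph.Causal T) (fun h _ => h)
    fun T T' δ hδ h1 hTL hT' hc c₁ c₂ =>
      (hc c₁ c₂).of_eq_apply_sub_smul c₂ hTL hL (by positivity) hδ h1 hT'
  exact ⟨hT.wellPosed hinj, T, hT.graph_eq_feedback hinj, hT.graph_eq_feedback' hinj,
    ScaledRelativeGraph.incGain_graph_le
      (hT.norm_sub_le hr_m (hbound 1 ⟨zero_le_one, le_rfl⟩)),
    fun c₁ c₂ => ⟨hcausal c₁ c₂, hT.wellPosed_extend hinj c₁ c₂ (hcausal c₁ c₂)⟩⟩
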